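/- Let $u\in\mathbb{C}$ with $\operatorname{Re}u>0$ (in particular any real $u>0$), and let $\log$ and complex powers be the principal ones. The Dirichlet series $\sum_{k\ge 0}(k+u)^{-s}$, which converges for $\operatorname{Re}s>1$, extends to a (unique) holomorphic function $s\mapsto\zeta(s,u)$ on $\mathbb{C}\setminus\{1\}$, the Hurwitz zeta function. Let the Stieltjes constants be $$\gamma_n(u)=(-1)^n\lim_{s\to1}\frac{d^n}{ds^n}\Big[\zeta(s,u)-\frac1{s-1}\Big]\qquad(n\ge 0);$$ they are the coefficients of the Laurent expansion of $\zeta(s,u)$ about $s=1$: $$\zeta(s,u)=\frac{1}{s-1}+\sum_{n=0}^{\infty}\frac{(-1)^n}{n!}\,\gamma_n(u)\,(s-1)^n\qquad(s\ne 1).$$ Then for every integer $n\ge 0$ $$\gamma_n(u)=-\frac{1}{n+1}\sum_{i=0}^{\infty}\frac{1}{i+1}\sum_{j=0}^{i}\binom{i}{j}(-1)^j\log^{n+1}(u+j),$$ where the series over $i$ converges absolutely. Moreover, $s\mapsto(s-1)\zeta(s,u)$, extended by the value $1$ at $s=1$, is an entire function, and for every integer $n\ge 0$ $$\left.\frac{d^{n+1}}{ds^{n+1}}\big[(s-1)\zeta(s,u)\big]\right|_{s=1}=(-1)^n(n+1)\,\gamma_n(u).$$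 -/

import Mathlib

open Filter Topology

namespace StieltjesConst

/-- `f` is the Hurwitz zeta function with parameter `u`: it is holomorphic on `ℂ ∖ {1}` and is
given by the Dirichlet series `∑_{k ≥ 0} 1 / (k + u) ^ s` on the half-plane `Re s > 1`.
(For `Re u > 0` the powers are principal powers of numbers in the right half-plane.) -/
def IsHurwitzZeta (u : ℂ) (f : ℂ → ℂ) : Prop :=
  DifferentiableOn ℂ f {1}ᶜ ∧
    ∀ s : ℂ, 1 < s.re → HasSum (fun k : ℕ => 1 / ((k : ℂ) + u) ^ s) (f s)

/-- The analytic continuation is unique on `ℂ ∖ {1}`. -/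
theorem IsHurwitzZeta.eq_of_ne_one {u : ℂ} {f g : ℂ → ℂ} (hf : IsHurwitzZeta u f)
    (hg : IsHurwitzZeta u g) {s : ℂ} (hs : s ≠ 1) : f s = g s := by
  have hopen : IsOpen ({1}ᶜ : Set ℂ) := isOpen_compl_singleton
  have hconn : IsPreconnected ({1}ᶜ : Set ℂ) :=
    (isConnected_compl_singleton_of_one_lt_rank (by simp) (1 : ℂ)).isPreconnected
  have h2 : (2 : ℂ) ∈ ({1}ᶜ : Set ℂ) := by simp
  have hev : f =ᶠ[𝓝 (2 : ℂ)] g := by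
    have hU : {z : ℂ | 1 < z.re} ∈ 𝓝 (2 : ℂ) :=
      (isOpen_lt continuous_const Complex.continuous_re).mem_nhds (by simp)
    filter_upwards [hU] with z hz
    exact (hf.2 z hz).unique (hg.2 z hz)
  exact (hf.1.analyticOnNhd hopen).eqOn_of_preconnected_of_eventuallyEq
    (hg.1.analyticOnNhd hopen) hconn h2 hev hs

/-- The Hurwitz zeta function `ζ(s, u)`, as the analytic continuation in `s` of
`∑_{k ≥ 0} 1 / (k + u) ^ s` to `ℂ ∖ {1}`; the value at the pole `s = 1` is meaningless. -/
noncomputable def zeta (s u : ℂ) : ℂ :=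
  Classical.epsilon (IsHurwitzZeta u) s

/-- The Stieltjes constant
`γ_n(u) = (-1)^n lim_{s → 1} (d/ds)^n [ζ(s, u) - 1 / (s - 1)]`, that is, `(-1)^n n!` times the
coefficient of `(s - 1)^n` in the Laurent expansion of `ζ(s, u)` about `s = 1`. -/
noncomputable def gamma (n : ℕ) (u : ℂ) : ℂ :=
  (-1) ^ n * limUnder (𝓝[≠] (1 : ℂ)) (iteratedDeriv n (fun s : ℂ => zeta s u - 1 / (s - 1)))

/-- The function `s ↦ (s - 1) ζ(s, u)`, with the removable singularity at `s = 1` filled in by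
its limit `1` there. -/
noncomputable def subOneMulZeta (u : ℂ) : ℂ → ℂ :=
  Function.update (fun s : ℂ => (s - 1) * zeta s u) 1 1

end StieltjesConst

namespace StieltjesConst

open MeasureTheory Set

/-! Everything follows from Hasse's series: `(s - 1) ζ(s, u)` is the sum over `i` of `1 / (i + 1)`
times the `i`-th difference of `x ^ (1 - s)` at `u`. For `Re s > 1` it comes from the integral of `t
^ (s - 1) e^{-ut} / (1 - e^{-t})`. A geometric expansion gives `Γ(s) ζ(s, u)`. Expanding `t / (1 -
e^{-t})` in powers of `1 - e^{-t}` gives differences of `x ^ (1 - s)` times `Γ(s - 1)`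
(`hasSum_dirichlet_of_hasSum_altDiff`). The differences are `O((i + 1) ^ (-d))` for every `0 < d <
Re u`, locally uniformly in all of `ℂ` (`exists_norm_altDiff_cpow_le`), so the series is an entire
function and may be differentiated termwise. At `s = 1` the `(n + 1)`-st derivative of the series
produces the powers of logarithms. The value there is `1`, so `(s - 1) ζ(s, u) = 1 + (s - 1) R(s)`
with `R` the regular part of `ζ`, and the same derivative is `(n + 1) R⁽ⁿ⁾(1) = (-1)^n (n + 1)
γ_n(u)`. -/

/-! ### Gamma integrals with a complex rate -/

theorem norm_cpow_mul_cexp_neg_mul (a r : ℂ) {t : ℝ} (ht : 0 < t) :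
    ‖(t : ℂ) ^ (a - 1) * Complex.exp (-(r * t))‖ =
      t ^ (a.re - 1) * Real.exp (-(r.re * t)) := by
  rw [norm_mul, Complex.norm_cpow_eq_rpow_re_of_pos ht, Complex.norm_exp]
  simp

theorem aestronglyMeasurable_cpow_mul_cexp_neg_mul (a r : ℂ) :
    AEStronglyMeasurable (fun t : ℝ => (t : ℂ) ^ (a - 1) * Complex.exp (-(r * t)))
      (volume.restrict (Ioi 0)) := by
  refine ContinuousOn.aestronglyMeasurable (fun t ht => ?_) measurableSet_Ioi
  refine ((Complex.continuousAt_ofReal_cpow_const t _ (Or.inr (ne_of_gt ht))).mul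
    ?_).continuousWithinAt
  fun_prop

theorem integrableOn_rpow_mul_exp_neg_mul {a r : ℝ} (ha : 0 < a) (hr : 0 < r) :
    IntegrableOn (fun t : ℝ => t ^ (a - 1) * Real.exp (-(r * t))) (Ioi 0) := by
  simpa using integrableOn_rpow_mul_exp_neg_mul_rpow (s := a - 1) (p := 1) (b := r)
    (by linarith) one_pos hr

theorem integrableOn_cpow_mul_cexp_neg_mul {a r : ℂ} (ha : 0 < a.re) (hr : 0 < r.re) :
    IntegrableOn (fun t : ℝ => (t : ℂ) ^ (a - 1) * Complex.exp (-(r * t))) (Ioi 0) := by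
  refine (integrableOn_rpow_mul_exp_neg_mul ha hr).mono'
    (aestronglyMeasurable_cpow_mul_cexp_neg_mul a r) ?_
  filter_upwards [ae_restrict_mem measurableSet_Ioi] with t ht
  exact (norm_cpow_mul_cexp_neg_mul a r ht).le

theorem integral_norm_cpow_mul_cexp_neg_mul {a r : ℂ} (ha : 0 < a.re) (hr : 0 < r.re) :
    ∫ t : ℝ in Ioi 0, ‖(t : ℂ) ^ (a - 1) * Complex.exp (-(r * t))‖ =
      (1 / r.re) ^ a.re * Real.Gamma a.re := by
  rw [← Real.integral_rpow_mul_exp_neg_mul_Ioi ha hr]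
  exact setIntegral_congr_fun measurableSet_Ioi
    fun t ht => norm_cpow_mul_cexp_neg_mul a r ht

theorem differentiableAt_integral_cpow_mul_cexp_neg_mul {a r : ℂ} (ha : 0 < a.re)
    (hr : 0 < r.re) :
    DifferentiableAt ℂ
      (fun r : ℂ => ∫ t : ℝ in Ioi 0, (t : ℂ) ^ (a - 1) * Complex.exp (-(r * t))) r := by
  have hs : {z : ℂ | r.re / 2 < z.re} ∈ 𝓝 r :=
    (isOpen_lt continuous_const Complex.continuous_re).mem_nhds (by simp; linarith)
  have hcongr : ∀ z : ℂ, ∀ t : ℝ, 0 < t →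
      -(t : ℂ) * ((t : ℂ) ^ (a - 1) * Complex.exp (-(z * t))) =
        -((t : ℂ) ^ (a + 1 - 1) * Complex.exp (-(z * t))) := by
    intro z t ht
    have ht' : (t : ℂ) ≠ 0 := by exact_mod_cast ht.ne'
    rw [show a + 1 - 1 = (a - 1) + 1 by ring, Complex.cpow_add _ _ ht', Complex.cpow_one]
    ring
  refine (hasDerivAt_integral_of_dominated_loc_of_deriv_le (μ := volume.restrict (Ioi (0 : ℝ)))
    (F := fun (z : ℂ) (t : ℝ) => (t : ℂ) ^ (a - 1) * Complex.exp (-(z * t)))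
    (F' := fun (z : ℂ) (t : ℝ) => -(t : ℂ) * ((t : ℂ) ^ (a - 1) * Complex.exp (-(z * t))))
    (bound := fun t => t ^ ((a + 1).re - 1) * Real.exp (-(r.re / 2 * t)))
    hs (Eventually.of_forall fun z => aestronglyMeasurable_cpow_mul_cexp_neg_mul a z)
    (integrableOn_cpow_mul_cexp_neg_mul ha hr) ?_ ?_
    (integrableOn_rpow_mul_exp_neg_mul (by simp; linarith) (by linarith)) ?_).2.differentiableAt
  · exact (Complex.continuous_ofReal.neg.aestronglyMeasurable).mul
      (aestronglyMeasurable_cpow_mul_cexp_neg_mul a r)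
  · filter_upwards [ae_restrict_mem measurableSet_Ioi] with t ht z hz
    rw [hcongr z t ht, norm_neg, norm_cpow_mul_cexp_neg_mul _ _ ht]
    have ht0 : (0 : ℝ) < t := ht
    have hz' : r.re / 2 < z.re := hz
    gcongr
  · refine Eventually.of_forall fun t z _ => ?_
    have h : HasDerivAt (fun z : ℂ => -(z * t)) (-(t : ℂ)) z := by
      simpa using ((hasDerivAt_id' z).mul_const (t : ℂ)).fun_neg
    exact (h.cexp.const_mul ((t : ℂ) ^ (a - 1))).congr_deriv (by ring)

theorem re_ne_zero_of_pos {r : ℂ} (hr : 0 < r.re) : r ≠ 0 := by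
  rintro rfl
  simp at hr

/-- The Gamma integral with a complex rate. -/
theorem integral_cpow_mul_cexp_neg_mul {a r : ℂ} (ha : 0 < a.re) (hr : 0 < r.re) :
    ∫ t : ℝ in Ioi 0, (t : ℂ) ^ (a - 1) * Complex.exp (-(r * t)) =
      r ^ (-a) * Complex.Gamma a := by
  have hopen : IsOpen {z : ℂ | 0 < z.re} := isOpen_lt continuous_const Complex.continuous_re
  have hf : DifferentiableOn ℂ
      (fun r : ℂ => ∫ t : ℝ in Ioi 0, (t : ℂ) ^ (a - 1) * Complex.exp (-(r * t)))
      {z : ℂ | 0 < z.re} := fun z hz =>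
    (differentiableAt_integral_cpow_mul_cexp_neg_mul ha hz).differentiableWithinAt
  have hg : DifferentiableOn ℂ (fun r : ℂ => r ^ (-a) * Complex.Gamma a)
      {z : ℂ | 0 < z.re} := fun z hz =>
    ((differentiableAt_id.cpow_const (Or.inl hz)).mul_const _).differentiableWithinAt
  -- Both sides are holomorphic in the rate, so agreement at real rates accumulating at `1`
  -- suffices.
  have hfreq : ∃ᶠ z in 𝓝[≠] (1 : ℂ),
      ∫ t : ℝ in Ioi 0, (t : ℂ) ^ (a - 1) * Complex.exp (-(z * t)) =
        z ^ (-a) * Complex.Gamma a := by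
    have htend : Tendsto (fun x : ℝ => (x : ℂ)) (𝓝[≠] 1) (𝓝[≠] (1 : ℂ)) := by
      refine tendsto_nhdsWithin_iff.2 ⟨?_, ?_⟩
      · exact (Complex.continuous_ofReal.tendsto' 1 1 (by simp)).mono_left nhdsWithin_le_nhds
      · filter_upwards [self_mem_nhdsWithin] with x hx
        simpa using hx
    refine htend.frequently (Eventually.frequently ?_)
    filter_upwards [nhdsWithin_le_nhds (Ioi_mem_nhds one_pos)] with x hx
    have hx0 : (0 : ℝ) < x := hx
    rw [Complex.integral_cpow_mul_exp_neg_mul_Ioi ha hx0, one_div, Complex.inv_cpow,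
      Complex.cpow_neg]
    rw [Complex.arg_ofReal_of_nonneg hx0.le]
    exact Real.pi_pos.ne
  exact (hf.analyticOnNhd hopen).eqOn_of_preconnected_of_frequently_eq
    (hg.analyticOnNhd hopen) (convex_halfSpace_re_gt 0).isPreconnected
    (by simp : (1 : ℂ) ∈ {z : ℂ | 0 < z.re}) hfreq hr

/-! ### Differences of powers: integral representation and decay -/

/-- The `i`-th backward difference `∑ j ≤ i, (-1) ^ j * choose i j * g (u + j)`. -/
noncomputable def altDiff (i : ℕ) (g : ℂ → ℂ) (u : ℂ) : ℂ :=
  ∑ j ∈ Finset.range (i + 1), (i.choose j : ℂ) * (-1) ^ j * g (u + j)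

theorem altDiff_congr {i : ℕ} {g h : ℂ → ℂ} {u : ℂ} (H : ∀ j : ℕ, g (u + j) = h (u + j)) :
    altDiff i g u = altDiff i h u :=
  Finset.sum_congr rfl fun j _ => by rw [H j]

/-- Split `x = u + j` and absorb `j` into the binomial coefficient. This recurrence carries bounds
from exponent `-(s + 1)` to `-s`. -/
theorem altDiff_succ_id_mul (i : ℕ) (g : ℂ → ℂ) (u : ℂ) :
    altDiff (i + 1) (fun x => x * g x) u =
      u * altDiff (i + 1) g u - (i + 1) * altDiff i g (u + 1) := by
  have h1 : altDiff (i + 1) (fun x => x * g x) u = u * altDiff (i + 1) g u +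
      ∑ j ∈ Finset.range (i + 2), ((i + 1).choose j : ℂ) * (-1) ^ j * (j * g (u + j)) := by
    simp only [altDiff, Finset.mul_sum]
    rw [← Finset.sum_add_distrib]
    exact Finset.sum_congr rfl fun j _ => by ring
  rw [h1, Finset.sum_range_succ', altDiff, altDiff, Finset.mul_sum, Finset.mul_sum,
    sub_eq_add_neg, ← Finset.sum_neg_distrib]
  simp only [Nat.cast_zero, zero_mul, mul_zero, add_zero]
  congr 1
  refine Finset.sum_congr rfl fun j _ => ?_
  have h2 : ((i : ℂ) + 1) * (i.choose j : ℂ) = ((i + 1).choose (j + 1) : ℂ) * (j + 1) := by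
    exact_mod_cast Nat.add_one_mul_choose_eq i j
  rw [show u + ((j + 1 : ℕ) : ℂ) = u + 1 + j by push_cast; ring, pow_succ]
  push_cast
  linear_combination ((-1) ^ j * g (u + 1 + j)) * h2

theorem cpow_mul_cexp_mul_one_sub_pow (s u : ℂ) (i : ℕ) (t : ℝ) :
    (t : ℂ) ^ (s - 1) * Complex.exp (-(u * t)) * (1 - Complex.exp (-t)) ^ i =
      ∑ j ∈ Finset.range (i + 1), (i.choose j : ℂ) * (-1) ^ j *
        ((t : ℂ) ^ (s - 1) * Complex.exp (-((u + j) * t))) := by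
  rw [sub_eq_neg_add 1, add_pow, Finset.mul_sum]
  refine Finset.sum_congr rfl fun j _ => ?_
  rw [neg_pow, ← Complex.exp_nat_mul, show -((u + j) * t) = -(u * t) + j * -(t : ℂ) by ring,
    Complex.exp_add]
  ring

theorem integrableOn_cpow_mul_cexp_mul_one_sub_pow {s u : ℂ} (hs : 0 < s.re) (hu : 0 < u.re)
    (i : ℕ) :
    IntegrableOn (fun t : ℝ => (t : ℂ) ^ (s - 1) * Complex.exp (-(u * t)) *
      (1 - Complex.exp (-t)) ^ i) (Ioi 0) := by
  simp_rw [cpow_mul_cexp_mul_one_sub_pow]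
  refine integrable_finsetSum _ fun j _ => Integrable.const_mul ?_ _
  exact integrableOn_cpow_mul_cexp_neg_mul hs (by simp; positivity)

theorem integral_cpow_mul_cexp_mul_one_sub_pow {s u : ℂ} (hs : 0 < s.re) (hu : 0 < u.re)
    (i : ℕ) :
    ∫ t : ℝ in Ioi 0, (t : ℂ) ^ (s - 1) * Complex.exp (-(u * t)) *
      (1 - Complex.exp (-t)) ^ i = altDiff i (fun x => x ^ (-s)) u * Complex.Gamma s := by
  have hj (j : ℕ) : 0 < (u + j).re := by simp; positivity
  simp_rw [cpow_mul_cexp_mul_one_sub_pow]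
  rw [integral_finsetSum _ fun j _ =>
    (integrableOn_cpow_mul_cexp_neg_mul hs (hj j)).const_mul _, altDiff, Finset.sum_mul]
  refine Finset.sum_congr rfl fun j _ => ?_
  rw [integral_const_mul, integral_cpow_mul_cexp_neg_mul hs (hj j)]
  ring

/-- With `x = e^{-t}` and `y = (i + 1) x`, one has `(1 - x) ^ i ≤ e · e^{-y}` and `y ^ d ≤ d ^ d
e^y`; in the product the exponentials of `y` cancel. -/
theorem exp_neg_mul_one_sub_exp_neg_pow_le {d t : ℝ} (hd : 0 < d) (ht : 0 < t) (i : ℕ) :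
    Real.exp (-(d * t)) * (1 - Real.exp (-t)) ^ i ≤
      Real.exp 1 * d ^ d * ((i : ℝ) + 1) ^ (-d) := by
  set x := Real.exp (-t) with hx
  have hx0 : 0 < x := Real.exp_pos _
  have hx1 : x ≤ 1 := Real.exp_le_one_iff.2 (by linarith)
  have h1 : (1 - x) ^ i ≤ Real.exp 1 * Real.exp (-((i + 1) * x)) := by
    calc (1 - x) ^ i ≤ (Real.exp (-x)) ^ i :=
          pow_le_pow_left₀ (by linarith) (Real.one_sub_le_exp_neg x) i
      _ = Real.exp (i * -x) := (Real.exp_nat_mul _ _).symm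
      -- Since `x ≤ 1`, one factor `e` pays for replacing `i` by `i + 1`.
      _ ≤ Real.exp (1 + -((i + 1) * x)) := Real.exp_le_exp.2 (by nlinarith)
      _ = _ := Real.exp_add _ _
  have hi : (0 : ℝ) < (i : ℝ) + 1 := by positivity
  have h2 : (((i : ℝ) + 1) * x) ^ d ≤ d ^ d * Real.exp (((i : ℝ) + 1) * x) := by
    have hy : 0 < ((i : ℝ) + 1) * x := by positivity
    set y := ((i : ℝ) + 1) * x
    have h3 : y ≤ d * Real.exp (y / d) := by
      have := Real.add_one_le_exp (y / d)
      calc y = d * (y / d) := by field_simp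
        _ ≤ d * Real.exp (y / d) := by gcongr; linarith
    calc y ^ d ≤ (d * Real.exp (y / d)) ^ d := Real.rpow_le_rpow hy.le h3 hd.le
      _ = d ^ d * Real.exp y := by
        rw [Real.mul_rpow hd.le (Real.exp_pos _).le, ← Real.exp_mul]
        congr 2
        field_simp
  have h4 : Real.exp (-(d * t)) = x ^ d := by
    rw [hx, ← Real.exp_mul]; congr 1; ring
  have h5 : x ^ d ≤ d ^ d * Real.exp (((i : ℝ) + 1) * x) * ((i : ℝ) + 1) ^ (-d) := by
    rw [Real.mul_rpow hi.le hx0.le] at h2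
    rw [Real.rpow_neg hi.le, ← div_eq_mul_inv, le_div_iff₀ (by positivity)]
    linarith
  rw [h4]
  calc x ^ d * (1 - x) ^ i
      ≤ (d ^ d * Real.exp (((i : ℝ) + 1) * x) * ((i : ℝ) + 1) ^ (-d)) *
          (Real.exp 1 * Real.exp (-((i + 1) * x))) := by
        gcongr
    _ = Real.exp 1 * d ^ d * ((i : ℝ) + 1) ^ (-d) *
          (Real.exp (((i : ℝ) + 1) * x) * Real.exp (-((i + 1) * x))) := by ring
    _ = _ := by rw [← Real.exp_add]; simp

/-- The constant in `integral_norm_cpow_mul_cexp_mul_one_sub_pow_le`. -/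
noncomputable def diffBound (d r σ : ℝ) : ℝ :=
  Real.exp 1 * d ^ d * ((1 / (r - d)) ^ σ * Real.Gamma σ)

theorem norm_one_sub_cexp_neg {t : ℝ} (ht : 0 < t) :
    ‖1 - Complex.exp (-(t : ℂ))‖ = 1 - Real.exp (-t) := by
  have h : (1 : ℂ) - Complex.exp (-(t : ℂ)) = ((1 - Real.exp (-t) : ℝ) : ℂ) := by push_cast; rfl
  have : Real.exp (-t) ≤ 1 := Real.exp_le_one_iff.2 (by linarith)
  rw [h, Complex.norm_of_nonneg (by linarith)]

/-- Of the exponential decay at rate `Re u`, the part `d` is spent on decay in `i`; the rest, `Re u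
- d`, keeps the integral finite. -/
theorem integral_norm_cpow_mul_cexp_mul_one_sub_pow_le {s u : ℂ} {d : ℝ} (hs : 0 < s.re)
    (hd : 0 < d) (hdu : d < u.re) (i : ℕ) :
    ∫ t : ℝ in Ioi 0, ‖(t : ℂ) ^ (s - 1) * Complex.exp (-(u * t)) *
      (1 - Complex.exp (-t)) ^ i‖ ≤ diffBound d u.re s.re * ((i : ℝ) + 1) ^ (-d) := by
  have hr : 0 < u.re - d := by linarith
  have hle : ∀ t ∈ Ioi (0 : ℝ), ‖(t : ℂ) ^ (s - 1) * Complex.exp (-(u * t)) *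
      (1 - Complex.exp (-t)) ^ i‖ ≤ Real.exp 1 * d ^ d * ((i : ℝ) + 1) ^ (-d) *
        (t ^ (s.re - 1) * Real.exp (-((u.re - d) * t))) := by
    intro t ht
    have ht0 : (0 : ℝ) < t := ht
    rw [norm_mul, norm_pow, norm_one_sub_cexp_neg ht0, norm_cpow_mul_cexp_neg_mul _ _ ht0,
      show -(u.re * t) = -((u.re - d) * t) + -(d * t) by ring, Real.exp_add]
    have := exp_neg_mul_one_sub_exp_neg_pow_le hd ht0 i
    calc _ = (Real.exp (-(d * t)) * (1 - Real.exp (-t)) ^ i) *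
          (t ^ (s.re - 1) * Real.exp (-((u.re - d) * t))) := by ring
      _ ≤ _ := by gcongr
  refine (setIntegral_mono_on
    (integrableOn_cpow_mul_cexp_mul_one_sub_pow hs (hd.trans hdu) i).norm
    ((integrableOn_rpow_mul_exp_neg_mul hs hr).const_mul _) measurableSet_Ioi hle).trans_eq ?_
  rw [integral_const_mul, Real.integral_rpow_mul_exp_neg_mul_Ioi hs hr, diffBound]
  ring

theorem continuousOn_diffBound {d r : ℝ} (hdr : d < r) :
    ContinuousOn (diffBound d r) (Ioi 0) := by
  refine continuousOn_const.mul (ContinuousOn.mul ?_ ?_)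
  · exact (Real.continuous_const_rpow (one_div_ne_zero (by linarith))).continuousOn
  · intro σ hσ
    have hσ0 : (0 : ℝ) < σ := hσ
    refine (Real.differentiableAt_Gamma fun m => ?_).continuousAt.continuousWithinAt
    have : (0 : ℝ) ≤ m := m.cast_nonneg
    linarith

theorem norm_altDiff_cpow_le_of_re_pos {s u : ℂ} {d : ℝ} (hs : 0 < s.re)
    (hd : 0 < d) (hdu : d < u.re) (i : ℕ) :
    ‖altDiff i (fun x => x ^ (-s)) u‖ ≤
      ‖(Complex.Gamma s)⁻¹‖ * diffBound d u.re s.re * ((i : ℝ) + 1) ^ (-d) := by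
  have hG : Complex.Gamma s ≠ 0 := Complex.Gamma_ne_zero_of_re_pos hs
  have h : altDiff i (fun x => x ^ (-s)) u = (Complex.Gamma s)⁻¹ *
      ∫ t : ℝ in Ioi 0, (t : ℂ) ^ (s - 1) * Complex.exp (-(u * t)) *
        (1 - Complex.exp (-t)) ^ i := by
    rw [integral_cpow_mul_cexp_mul_one_sub_pow hs (hd.trans hdu)]
    field_simp
  rw [h, norm_mul, mul_assoc]
  gcongr
  exact (norm_integral_le_integral_norm _).trans
    (integral_norm_cpow_mul_cexp_mul_one_sub_pow_le hs hd hdu i)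

/-- The backward differences of `x ^ (-s)` decay like a power, locally uniformly in `s ∈ ℂ`. -/
theorem exists_norm_altDiff_cpow_le (N : ℕ) : ∀ (u : ℂ) (d : ℝ), 0 < d → d < u.re →
    ∃ A : ℂ → ℝ, ContinuousOn A {s | -(N : ℝ) < s.re} ∧ ∀ s : ℂ, -(N : ℝ) < s.re → ∀ i : ℕ,
      ‖altDiff i (fun x => x ^ (-s)) u‖ ≤ A s * ((i : ℝ) + 1) ^ (-d) := by
  induction N with
  | zero =>
    intro u d hd hdu
    refine ⟨fun s => ‖(Complex.Gamma s)⁻¹‖ * diffBound d u.re s.re, ?_, fun s hs i =>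
      norm_altDiff_cpow_le_of_re_pos (by simpa using hs) hd hdu i⟩
    refine Complex.differentiable_one_div_Gamma.continuous.norm.continuousOn.mul ?_
    exact (continuousOn_diffBound hdu).comp Complex.continuous_re.continuousOn
      fun s hs => by simpa using hs
  | succ N ih =>
    intro u d hd hdu
    obtain ⟨A, hAc, hA⟩ := ih u d hd hdu
    -- Shifting `u` by one allows the exponent `d + 1`, which compensates the factor `i + 1` in the
    -- recurrence.
    obtain ⟨B, hBc, hB⟩ := ih (u + 1) (d + 1) (by linarith) (by simpa using hdu)
    have hmaps : MapsTo (fun s : ℂ => s + 1) {s | -((N + 1 : ℕ) : ℝ) < s.re}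
        {s | -(N : ℝ) < s.re} := by
      intro s hs
      simp only [mem_ofPred_eq, Nat.cast_add, Nat.cast_one, Complex.add_re, Complex.one_re] at hs ⊢
      linarith
    refine ⟨fun s => ‖u‖ * A (s + 1) + B (s + 1) * 2 ^ d, ?_, fun s hs i => ?_⟩
    · have hc : ContinuousOn (fun s : ℂ => s + 1) {s | -((N + 1 : ℕ) : ℝ) < s.re} := by fun_prop
      exact (continuousOn_const.mul (hAc.comp hc hmaps)).add
        ((hBc.comp hc hmaps).mul continuousOn_const)
    have hs' := hmaps hs
    have hB0 : 0 ≤ B (s + 1) := by simpa using (norm_nonneg _).trans (hB _ hs' 0)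
    have hrw : altDiff i (fun x => x ^ (-s)) u =
        altDiff i (fun x => x * x ^ (-(s + 1))) u := by
      refine altDiff_congr fun j => ?_
      have hu0 : 0 < u.re := hd.trans hdu
      have hj : u + j ≠ 0 := re_ne_zero_of_pos (by simp; positivity)
      rw [show -s = -(s + 1) + 1 by ring, Complex.cpow_add _ _ hj, Complex.cpow_one, mul_comm]
    rw [hrw]
    cases i with
    | zero =>
      have h := hA _ hs' 0
      simp only [altDiff, zero_add, Finset.sum_range_one, Nat.choose_self, Nat.cast_one, pow_zero,
        Nat.cast_zero, add_zero, one_mul, Real.one_rpow, mul_one, norm_mul] at h ⊢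
      have : 0 ≤ B (s + 1) * 2 ^ d := by positivity
      nlinarith [norm_nonneg u]
    | succ i =>
      rw [altDiff_succ_id_mul]
      have h1 := hA _ hs' (i + 1)
      have h2 := hB _ hs' i
      have hi : (0 : ℝ) < (i : ℝ) + 1 := by positivity
      have h3 : ((i : ℝ) + 1) * ((i : ℝ) + 1) ^ (-(d + 1)) = ((i : ℝ) + 1) ^ (-d) := by
        rw [show -d = 1 + -(d + 1) by ring, Real.rpow_add hi, Real.rpow_one]
      -- The index shift costs `2 ^ d`, because `i + 2 ≤ 2 (i + 1)`.
      have h4 : ((i : ℝ) + 1) ^ (-d) ≤ 2 ^ d * (((i + 1 : ℕ) : ℝ) + 1) ^ (-d) := by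
        rw [Real.rpow_neg hi.le, Real.rpow_neg (by positivity), ← div_eq_mul_inv,
          ← Real.div_rpow (by norm_num) (by positivity), ← Real.inv_rpow hi.le]
        refine Real.rpow_le_rpow (by positivity) ?_ hd.le
        rw [inv_eq_one_div, div_le_div_iff₀ hi (by positivity)]
        push_cast
        linarith
      calc _ ≤ ‖u‖ * ‖altDiff (i + 1) (fun x => x ^ (-(s + 1))) u‖ +
            ((i : ℝ) + 1) * ‖altDiff i (fun x => x ^ (-(s + 1))) (u + 1)‖ := by
            refine (norm_sub_le _ _).trans_eq ?_
            rw [norm_mul, norm_mul]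
            congr 2
            exact_mod_cast Complex.norm_natCast (i + 1)
        _ ≤ ‖u‖ * (A (s + 1) * (((i + 1 : ℕ) : ℝ) + 1) ^ (-d)) +
            ((i : ℝ) + 1) * (B (s + 1) * ((i : ℝ) + 1) ^ (-(d + 1))) := by gcongr
        _ = ‖u‖ * A (s + 1) * (((i + 1 : ℕ) : ℝ) + 1) ^ (-d) +
            B (s + 1) * ((i : ℝ) + 1) ^ (-d) := by rw [← h3]; ring
        _ ≤ ‖u‖ * A (s + 1) * (((i + 1 : ℕ) : ℝ) + 1) ^ (-d) +
            B (s + 1) * (2 ^ d * (((i + 1 : ℕ) : ℝ) + 1) ^ (-d)) := by gcongr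
        _ = _ := by ring

/-! ### From differences to the Dirichlet series -/

theorem summable_rpow_neg_div {d : ℝ} (hd : 0 < d) :
    Summable fun i : ℕ => ((i : ℝ) + 1) ^ (-d) / ((i : ℝ) + 1) := by
  refine ((Real.summable_one_div_nat_add_rpow 1 (d + 1)).2 (by linarith)).congr fun i => ?_
  have hi : (0 : ℝ) < (i : ℝ) + 1 := by positivity
  rw [abs_of_pos hi, Real.rpow_add hi, Real.rpow_neg hi.le, Real.rpow_one]
  field_simp

/-- This is the series of `-log (1 - x)` at `x = 1 - e^{-t}`, divided by `x`. -/
theorem hasSum_pow_div_add_one {t : ℝ} (ht : 0 < t) :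
    HasSum (fun i : ℕ => (1 - Complex.exp (-t)) ^ i / ((i : ℂ) + 1))
      (t / (1 - Complex.exp (-t))) := by
  have hlt : Real.exp (-t) < 1 := Real.exp_lt_one_iff.2 (by linarith)
  have hpos := Real.exp_pos (-t)
  have h := Real.hasSum_pow_div_log_of_abs_lt_one (x := 1 - Real.exp (-t))
    (by rw [abs_of_pos] <;> linarith)
  rw [sub_sub_cancel, Real.log_exp, neg_neg] at h
  have h2 := (Complex.hasSum_ofReal.2 h).div_const ((1 - Real.exp (-t) : ℝ) : ℂ)
  have hne : (1 : ℂ) - Complex.exp (-t) ≠ 0 := by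
    have : ((1 - Real.exp (-t) : ℝ) : ℂ) ≠ 0 := by exact_mod_cast (by linarith)
    simpa using this
  convert! h2 using 1
  · funext i
    push_cast
    rw [pow_succ]
    field_simp
  · push_cast
    rfl

theorem hasSum_altDiff_cpow_integral {s u : ℂ} (hs : 0 < s.re) (hu : 0 < u.re) :
    HasSum (fun i : ℕ => altDiff i (fun x => x ^ (-s)) u * Complex.Gamma s / ((i : ℂ) + 1))
      (∫ t : ℝ in Ioi 0, (t : ℂ) ^ (s + 1 - 1) * Complex.exp (-(u * t)) /
        (1 - Complex.exp (-t))) := by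
  have hd : 0 < u.re / 2 := by linarith
  have key := hasSum_integral_of_summable_integral_norm (μ := volume.restrict (Ioi (0 : ℝ)))
    (F := fun (i : ℕ) (t : ℝ) => (t : ℂ) ^ (s - 1) * Complex.exp (-(u * t)) *
        (1 - Complex.exp (-t)) ^ i / ((i : ℂ) + 1))
    (fun i => (integrableOn_cpow_mul_cexp_mul_one_sub_pow hs hu i).div_const _) ?_
  · convert! key using 1
    · funext i
      rw [integral_div, integral_cpow_mul_cexp_mul_one_sub_pow hs hu]
    · refine setIntegral_congr_fun measurableSet_Ioi fun t ht => ?_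
      have ht0 : (t : ℂ) ≠ 0 := by exact_mod_cast (ne_of_gt ht)
      have h := (hasSum_pow_div_add_one ht).mul_left
        ((t : ℂ) ^ (s - 1) * Complex.exp (-(u * t)))
      simp only [mul_div_assoc] at h ⊢
      rw [h.tsum_eq, show s + 1 - 1 = s - 1 + 1 by ring, Complex.cpow_add _ _ ht0,
        Complex.cpow_one]
      ring
  · refine Summable.of_nonneg_of_le (fun i => integral_nonneg fun t => norm_nonneg _)
      (fun i => ?_) ((summable_rpow_neg_div hd).mul_left (diffBound (u.re / 2) u.re s.re))
    have hn : ‖(i : ℂ) + 1‖ = (i : ℝ) + 1 := by exact_mod_cast Complex.norm_natCast (i + 1)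
    simp_rw [norm_div, hn]
    rw [integral_div, ← mul_div_assoc]
    gcongr
    exact_mod_cast integral_norm_cpow_mul_cexp_mul_one_sub_pow_le hs hd (by linarith) i

theorem hasSum_cpow_integral {s u : ℂ} (hs : 1 < s.re) (hu : 0 < u.re) :
    HasSum (fun k : ℕ => (u + k) ^ (-s) * Complex.Gamma s)
      (∫ t : ℝ in Ioi 0, (t : ℂ) ^ (s - 1) * Complex.exp (-(u * t)) /
        (1 - Complex.exp (-t))) := by
  have hs0 : 0 < s.re := by linarith
  have hk (k : ℕ) : 0 < (u + k).re := by simp; positivity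
  have key := hasSum_integral_of_summable_integral_norm (μ := volume.restrict (Ioi (0 : ℝ)))
    (F := fun (k : ℕ) (t : ℝ) => (t : ℂ) ^ (s - 1) * Complex.exp (-((u + k) * t)))
    (fun k => integrableOn_cpow_mul_cexp_neg_mul hs0 (hk k)) ?_
  · convert! key using 1
    · funext k
      rw [integral_cpow_mul_cexp_neg_mul hs0 (hk k)]
    · refine setIntegral_congr_fun measurableSet_Ioi fun t ht => ?_
      have hlt : ‖Complex.exp (-(t : ℂ))‖ < 1 := by
        rw [Complex.norm_exp]
        exact Real.exp_lt_one_iff.2 (by simpa using ht)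
      have h := (hasSum_geometric_of_norm_lt_one hlt).mul_left
        ((t : ℂ) ^ (s - 1) * Complex.exp (-(u * t)))
      rw [div_eq_mul_inv]
      refine (h.tsum_eq.symm.trans (tsum_congr fun k => ?_))
      rw [← Complex.exp_nat_mul, mul_assoc, ← Complex.exp_add]
      ring_nf
  · refine (((Real.summable_one_div_nat_add_rpow u.re s.re).2 hs).mul_right
      (Real.Gamma s.re)).congr fun k => ?_
    have hk' : 0 < (k : ℝ) + u.re := by positivity
    rw [integral_norm_cpow_mul_cexp_neg_mul hs0 (hk k), abs_of_pos hk',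
      Real.div_rpow zero_le_one (hk k).le, Real.one_rpow]
    simp [add_comm]

/-- The logarithmic expansion at `s - 1` and the geometric one at `s` evaluate the same integral;
`Γ(s) = (s - 1) Γ(s - 1)` then cancels the Gamma factors. -/
theorem hasSum_dirichlet_of_hasSum_altDiff {s u S : ℂ} (hs : 1 < s.re) (hu : 0 < u.re)
    (hS : HasSum (fun i : ℕ => altDiff i (fun x => x ^ (1 - s)) u / ((i : ℂ) + 1)) S) :
    HasSum (fun k : ℕ => 1 / ((k : ℂ) + u) ^ s) (S / (s - 1)) := by
  have hs1 : 0 < (s - 1).re := by simpa using hs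
  have hG := Complex.Gamma_ne_zero_of_re_pos hs1
  have hne : s - 1 ≠ 0 := re_ne_zero_of_pos hs1
  have h1 := hasSum_altDiff_cpow_integral hs1 hu
  have h2 := hasSum_cpow_integral hs hu
  rw [sub_add_cancel] at h1
  have h3 : HasSum (fun i : ℕ => altDiff i (fun x => x ^ (-(s - 1))) u *
      Complex.Gamma (s - 1) / ((i : ℂ) + 1)) (S * Complex.Gamma (s - 1)) := by
    refine (hS.mul_right (Complex.Gamma (s - 1))).congr_fun fun i => ?_
    rw [neg_sub]
    ring
  have hGs : Complex.Gamma s = (s - 1) * Complex.Gamma (s - 1) := by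
    simpa using Complex.Gamma_add_one (s - 1) hne
  rw [← h3.unique h1, hGs] at h2
  have h4 := h2.div_const ((s - 1) * Complex.Gamma (s - 1))
  convert! h4 using 1
  · funext k
    rw [add_comm (k : ℂ) u, Complex.cpow_neg, mul_div_assoc, div_self (mul_ne_zero hne hG),
      mul_one, one_div]
  · field_simp

/-! ### Hasse's series as an entire function -/

theorem hasSum_iteratedDeriv_of_tendstoLocallyUniformlyOn {ι : Type*} {f : ι → ℂ → ℂ} {G : ℂ → ℂ}
    (hf : ∀ i, Differentiable ℂ (f i))
    (h : TendstoLocallyUniformlyOn (fun (t : Finset ι) s => ∑ i ∈ t, f i s) G atTop univ)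
    (n : ℕ) (s : ℂ) :
    HasSum (fun i => iteratedDeriv n (f i) s) (iteratedDeriv n G s) := by
  have hsum (t : Finset ι) : Differentiable ℂ fun s => ∑ i ∈ t, f i s :=
    Differentiable.fun_sum fun i _ => hf i
  have key : TendstoLocallyUniformlyOn
      (fun (t : Finset ι) => iteratedDeriv n fun s => ∑ i ∈ t, f i s)
      (iteratedDeriv n G) atTop univ := by
    induction n with
    | zero => simpa only [iteratedDeriv_zero] using h
    | succ n ih =>
      simp only [iteratedDeriv_succ]
      refine ih.deriv (Eventually.of_forall fun t => ?_) isOpen_univ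
      exact ((hsum t).contDiff.differentiable_iteratedDeriv n (WithTop.coe_lt_top _)).differentiableOn
  refine (key.tendsto_at (mem_univ s)).congr fun t => ?_
  exact iteratedDeriv_fun_sum fun i _ => (hf i).contDiff.contDiffAt

/-- The terms of Hasse's series for `(s - 1) ζ(s, u)`. -/
noncomputable def hasseTerm (u : ℂ) (i : ℕ) (s : ℂ) : ℂ :=
  altDiff i (fun x => x ^ (1 - s)) u / ((i : ℂ) + 1)

/-- Hasse's globally convergent series for `(s - 1) ζ(s, u)`. -/
noncomputable def hasse (u s : ℂ) : ℂ :=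
  ∑' i : ℕ, hasseTerm u i s

theorem add_natCast_ne_zero {u : ℂ} (hu : 0 < u.re) (j : ℕ) : u + j ≠ 0 :=
  re_ne_zero_of_pos (by simp; positivity)

theorem differentiable_hasseTerm {u : ℂ} (hu : 0 < u.re) (i : ℕ) :
    Differentiable ℂ (hasseTerm u i) := by
  unfold hasseTerm altDiff
  refine Differentiable.div_const (Differentiable.fun_sum fun j _ => ?_) _
  refine Differentiable.const_mul (fun s => ?_) _
  exact ((differentiableAt_const _).sub differentiableAt_id).const_cpow
    (Or.inl (add_natCast_ne_zero hu j))

theorem exists_summable_norm_hasseTerm_le {u : ℂ} (hu : 0 < u.re) {K : Set ℂ}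
    (hK : IsCompact K) :
    ∃ b : ℕ → ℝ, Summable b ∧ ∀ i, ∀ s ∈ K, ‖hasseTerm u i s‖ ≤ b i := by
  obtain ⟨R, hR⟩ := hK.isBounded.exists_norm_le
  -- The terms involve `x ^ (-(s - 1))`, so the decay bound is needed at `s - 1`, whose real part is
  -- at least `-R - 1`.
  obtain ⟨N, hN⟩ := exists_nat_gt (R + 1)
  have hd : 0 < u.re / 2 := by linarith
  obtain ⟨A, hAc, hA⟩ := exists_norm_altDiff_cpow_le N u (u.re / 2) hd (by linarith)
  have hmaps : MapsTo (fun s : ℂ => s - 1) K {s | -(N : ℝ) < s.re} := by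
    intro s hs
    have h1 := (abs_le.1 ((Complex.abs_re_le_norm s).trans (hR s hs))).1
    simp only [mem_ofPred_eq, Complex.sub_re, Complex.one_re]
    linarith
  have hc : ContinuousOn (fun s => A (s - 1)) K := hAc.comp (by fun_prop) hmaps
  obtain ⟨M, hM⟩ := hK.exists_bound_of_continuousOn hc
  refine ⟨fun i => M * (((i : ℝ) + 1) ^ (-(u.re / 2)) / ((i : ℝ) + 1)),
    (summable_rpow_neg_div hd).mul_left M, fun i s hs => ?_⟩
  have h1 := hA _ (hmaps hs) i
  have hn : ‖(i : ℂ) + 1‖ = (i : ℝ) + 1 := by exact_mod_cast Complex.norm_natCast (i + 1)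
  rw [neg_sub] at h1
  simp only [hasseTerm, norm_div, hn, ← mul_div_assoc]
  gcongr
  refine h1.trans ?_
  gcongr
  exact (le_abs_self _).trans (hM s hs)

theorem tendstoLocallyUniformlyOn_hasse {u : ℂ} (hu : 0 < u.re) :
    TendstoLocallyUniformlyOn (fun (t : Finset ℕ) s => ∑ i ∈ t, hasseTerm u i s) (hasse u)
      atTop univ := by
  rw [tendstoLocallyUniformlyOn_iff_forall_isCompact isOpen_univ]
  intro K _ hK
  obtain ⟨b, hb, hle⟩ := exists_summable_norm_hasseTerm_le hu hK
  exact tendstoUniformlyOn_tsum hb hle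

theorem differentiable_hasse {u : ℂ} (hu : 0 < u.re) : Differentiable ℂ (hasse u) := by
  rw [← differentiableOn_univ]
  refine (tendstoLocallyUniformlyOn_hasse hu).differentiableOn
    (Eventually.of_forall fun t => ?_) isOpen_univ
  exact (Differentiable.fun_sum fun i _ => differentiable_hasseTerm hu i).differentiableOn

theorem hasSum_hasse {u : ℂ} (hu : 0 < u.re) (s : ℂ) :
    HasSum (fun i => hasseTerm u i s) (hasse u s) :=
  (tendstoLocallyUniformlyOn_hasse hu).tendsto_at (mem_univ s)

/-- At `s = 1` the differences are those of the constant `1`, so only `i = 0` survives. -/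
theorem hasse_one (u : ℂ) : hasse u 1 = 1 := by
  have h (i : ℕ) : hasseTerm u i 1 = if i = 0 then 1 else 0 := by
    have h1 : ∑ j ∈ Finset.range (i + 1), (i.choose j : ℂ) * (-1) ^ j =
        if i = 0 then 1 else 0 := by
      have h2 := congrArg (Int.cast : ℤ → ℂ) (Int.alternating_sum_range_choose (n := i))
      push_cast at h2
      rw [← h2]
      exact Finset.sum_congr rfl fun j _ => mul_comm _ _
    simp only [hasseTerm, altDiff, sub_self, Complex.cpow_zero, mul_one, h1]
    split_ifs with hi <;> simp [hi]
  simp [hasse, h]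

theorem iteratedDeriv_const_cpow_one_sub {x : ℂ} (hx : x ≠ 0) (n : ℕ) :
    iteratedDeriv n (fun s : ℂ => x ^ (1 - s)) 1 = (-1) ^ n * Complex.log x ^ n := by
  have h := congrFun (iteratedDeriv_comp_const_sub n
    (fun z : ℂ => Complex.exp (Complex.log x * z)) 1) 1
  rw [iteratedDeriv_cexp_const_mul] at h
  simpa [Complex.cpow_def_of_ne_zero hx] using h

theorem iteratedDeriv_hasseTerm {u : ℂ} (hu : 0 < u.re) (n i : ℕ) :
    iteratedDeriv n (hasseTerm u i) 1 = (-1) ^ n * (1 / ((i : ℂ) + 1) *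
      ∑ j ∈ Finset.range (i + 1), (i.choose j : ℂ) * (-1) ^ j * Complex.log (u + j) ^ n) := by
  have hd (j : ℕ) : Differentiable ℂ fun s : ℂ => (u + j) ^ (1 - s) := fun s =>
    ((differentiableAt_const _).sub differentiableAt_id).const_cpow
      (Or.inl (add_natCast_ne_zero hu j))
  have h1 : hasseTerm u i = fun s => 1 / ((i : ℂ) + 1) *
      ∑ j ∈ Finset.range (i + 1), (i.choose j : ℂ) * (-1) ^ j * (u + j) ^ (1 - s) := by
    funext s
    rw [hasseTerm, altDiff]
    ring
  rw [h1, iteratedDeriv_const_mul_field,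
    iteratedDeriv_fun_sum fun j _ => ((hd j).const_mul _).contDiff.contDiffAt, Finset.mul_sum,
    Finset.mul_sum, Finset.mul_sum]
  refine Finset.sum_congr rfl fun j _ => ?_
  rw [iteratedDeriv_const_mul_field,
    iteratedDeriv_const_cpow_one_sub (add_natCast_ne_zero hu j)]
  ring

/-! ### The Hurwitz zeta function and its Stieltjes constants -/

theorem isHurwitzZeta_hasse_div {u : ℂ} (hu : 0 < u.re) :
    IsHurwitzZeta u fun s => hasse u s / (s - 1) := by
  refine ⟨fun s hs => ?_, fun s hs =>
    hasSum_dirichlet_of_hasSum_altDiff hs hu (hasSum_hasse hu s)⟩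
  have hs1 : s - 1 ≠ 0 := sub_ne_zero.2 hs
  exact ((differentiable_hasse hu s).fun_div (differentiableAt_id.sub_const 1)
    hs1).differentiableWithinAt

theorem isHurwitzZeta_zeta {u : ℂ} (hu : 0 < u.re) : IsHurwitzZeta u fun s => zeta s u :=
  Classical.epsilon_spec (p := IsHurwitzZeta u) ⟨_, isHurwitzZeta_hasse_div hu⟩

theorem zeta_eq_hasse_div {u s : ℂ} (hu : 0 < u.re) (hs : s ≠ 1) :
    zeta s u = hasse u s / (s - 1) :=
  (isHurwitzZeta_zeta hu).eq_of_ne_one (isHurwitzZeta_hasse_div hu) hs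

theorem subOneMulZeta_eq_hasse {u : ℂ} (hu : 0 < u.re) : subOneMulZeta u = hasse u := by
  funext s
  by_cases hs : s = 1
  · simp [subOneMulZeta, hs, hasse_one]
  · rw [subOneMulZeta, Function.update_of_ne hs, zeta_eq_hasse_div hu hs,
      mul_div_cancel₀ _ (sub_ne_zero.2 hs)]

/-- The regular part `ζ(s, u) - 1 / (s - 1)`, with the removable singularity filled in. -/
noncomputable def regularPart (u : ℂ) : ℂ → ℂ := dslope (hasse u) 1

theorem differentiable_regularPart {u : ℂ} (hu : 0 < u.re) :
    Differentiable ℂ (regularPart u) := by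
  rw [← differentiableOn_univ]
  exact (Complex.differentiableOn_dslope univ_mem).2 (differentiable_hasse hu).differentiableOn

theorem zeta_sub_eq_regularPart {u s : ℂ} (hu : 0 < u.re) (hs : s ≠ 1) :
    zeta s u - 1 / (s - 1) = regularPart u s := by
  rw [regularPart, dslope_of_ne _ hs, slope_def_field, hasse_one, zeta_eq_hasse_div hu hs, sub_div]

/-- Near each point other than `1` the differentiated function coincides with the entire
`regularPart`, whose derivatives are continuous at `1`. -/
theorem gamma_eq_iteratedDeriv_regularPart {u : ℂ} (hu : 0 < u.re) (n : ℕ) :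
    gamma n u = (-1) ^ n * iteratedDeriv n (regularPart u) 1 := by
  have hcont : Continuous (iteratedDeriv n (regularPart u)) :=
    (differentiable_regularPart hu).contDiff.continuous_iteratedDeriv n le_top
  have hlim : Tendsto (iteratedDeriv n fun s : ℂ => zeta s u - 1 / (s - 1)) (𝓝[≠] 1)
      (𝓝 (iteratedDeriv n (regularPart u) 1)) := by
    refine (hcont.continuousAt.tendsto.mono_left nhdsWithin_le_nhds).congr' ?_
    filter_upwards [self_mem_nhdsWithin] with s hs
    refine (EventuallyEq.iteratedDeriv_eq n ?_).symm
    filter_upwards [isOpen_ne.mem_nhds hs] with z hz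
    exact zeta_sub_eq_regularPart hu hz
  rw [gamma, hlim.limUnder_eq]

theorem iteratedDeriv_succ_sub_mul {f : ℂ → ℂ} (hf : Differentiable ℂ f) (c : ℂ) (n : ℕ) :
    iteratedDeriv (n + 1) (fun s => (s - c) * f s) =
      fun s => (s - c) * iteratedDeriv (n + 1) f s + (n + 1) * iteratedDeriv n f s := by
  have hd (m : ℕ) (s : ℂ) : HasDerivAt (iteratedDeriv m f) (iteratedDeriv (m + 1) f s) s := by
    rw [iteratedDeriv_succ]
    exact (hf.contDiff.differentiable_iteratedDeriv m (WithTop.coe_lt_top _) s).hasDerivAt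
  have hsub (s : ℂ) : HasDerivAt (fun s => s - c) 1 s := (hasDerivAt_id' s).sub_const c
  induction n with
  | zero =>
    funext s
    rw [zero_add, iteratedDeriv_one]
    have h := (hsub s).fun_mul (hd 0 s)
    simp only [iteratedDeriv_zero, zero_add] at h ⊢
    rw [h.deriv]
    push_cast
    ring
  | succ n ih =>
    funext s
    rw [iteratedDeriv_succ, ih]
    have h := ((hsub s).fun_mul (hd (n + 1) s)).fun_add ((hd n s).const_mul ((n : ℂ) + 1))
    rw [h.deriv]
    push_cast
    ring

theorem iteratedDeriv_succ_hasse_one {u : ℂ} (hu : 0 < u.re) (n : ℕ) :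
    iteratedDeriv (n + 1) (hasse u) 1 = (-1) ^ n * ((n : ℂ) + 1) * gamma n u := by
  have h1 : hasse u = fun s => 1 + (s - 1) * regularPart u s := by
    funext s
    have h := sub_smul_dslope (hasse u) 1 s
    rw [smul_eq_mul, hasse_one] at h
    rw [regularPart, h]
    ring
  have hsq : ((-1 : ℂ) ^ n) * (-1) ^ n = 1 := by rw [← mul_pow]; simp
  rw [h1, iteratedDeriv_const_add (Nat.succ_pos n),
    iteratedDeriv_succ_sub_mul (differentiable_regularPart hu), gamma_eq_iteratedDeriv_regularPart hu]
  linear_combination (-((n : ℂ) + 1) * iteratedDeriv n (regularPart u) 1) * hsq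

theorem hasSum_laurent_zeta {u s : ℂ} (hu : 0 < u.re) (hs : s ≠ 1) :
    HasSum (fun n : ℕ => (-1) ^ n / (n.factorial : ℂ) * gamma n u * (s - 1) ^ n)
      (zeta s u - 1 / (s - 1)) := by
  rw [zeta_sub_eq_regularPart hu hs]
  refine (Complex.hasSum_taylorSeries_of_entire (differentiable_regularPart hu) 1 s).congr_fun
    fun n => ?_
  have hsq : ((-1 : ℂ) ^ n) * (-1) ^ n = 1 := by rw [← mul_pow]; simp
  rw [gamma_eq_iteratedDeriv_regularPart hu, smul_eq_mul, smul_eq_mul]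
  linear_combination ((n.factorial : ℂ)⁻¹ * (s - 1) ^ n * iteratedDeriv n (regularPart u) 1) * hsq

theorem hasSum_log_series {u : ℂ} (hu : 0 < u.re) (n : ℕ) :
    HasSum (fun i : ℕ => 1 / ((i : ℂ) + 1) * ∑ j ∈ Finset.range (i + 1),
      (i.choose j : ℂ) * (-1) ^ j * Complex.log (u + (j : ℂ)) ^ (n + 1))
      (-(((n : ℂ) + 1) * gamma n u)) := by
  have h := (hasSum_iteratedDeriv_of_tendstoLocallyUniformlyOn (differentiable_hasseTerm hu)
    (tendstoLocallyUniformlyOn_hasse hu) (n + 1) 1).mul_left ((-1) ^ (n + 1))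
  have hsq (m : ℕ) : ((-1 : ℂ) ^ m) * (-1) ^ m = 1 := by rw [← mul_pow]; simp
  -- Each of the `n + 1` derivatives of `x ^ (1 - s)` contributes `-log x`; the prefactor removes
  -- these signs.
  simp only [iteratedDeriv_hasseTerm hu, ← mul_assoc ((-1 : ℂ) ^ (n + 1)) ((-1) ^ (n + 1)),
    hsq, one_mul] at h
  convert! h using 1
  rw [iteratedDeriv_succ_hasse_one hu, pow_succ]
  linear_combination (((n : ℂ) + 1) * gamma n u) * hsq n

end StieltjesConst

theorem mainTheorem6 (u : ℂ) (hu : 0 < u.re) :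
    -- `ζ(·, u)` is the analytic continuation of the Dirichlet series
    StieltjesConst.IsHurwitzZeta u (fun s => StieltjesConst.zeta s u) ∧
    -- the `γ_n(u)` are its Laurent coefficients about `s = 1`
    (∀ s : ℂ, s ≠ 1 →
      HasSum (fun n : ℕ => (-1) ^ n / (n.factorial : ℂ) * StieltjesConst.gamma n u * (s - 1) ^ n)
        (StieltjesConst.zeta s u - 1 / (s - 1))) ∧
    -- the series representation of `γ_n(u)`
    (∀ n : ℕ,
      Summable (fun i : ℕ => 1 / ((i : ℂ) + 1) *
        ∑ j ∈ Finset.range (i + 1),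
          (i.choose j : ℂ) * (-1) ^ j * Complex.log (u + (j : ℂ)) ^ (n + 1)) ∧
      StieltjesConst.gamma n u = -(1 / ((n : ℂ) + 1)) *
        ∑' i : ℕ, 1 / ((i : ℂ) + 1) *
          ∑ j ∈ Finset.range (i + 1),
            (i.choose j : ℂ) * (-1) ^ j * Complex.log (u + (j : ℂ)) ^ (n + 1)) ∧
    -- the derivatives of `(s - 1) ζ(s, u)` at `s = 1`
    Differentiable ℂ (StieltjesConst.subOneMulZeta u) ∧
    (∀ n : ℕ, iteratedDeriv (n + 1) (StieltjesConst.subOneMulZeta u) 1 =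
      (-1) ^ n * ((n : ℂ) + 1) * StieltjesConst.gamma n u) := by
  refine ⟨StieltjesConst.isHurwitzZeta_zeta hu,
    fun s hs => StieltjesConst.hasSum_laurent_zeta hu hs, fun n => ?_, ?_, fun n => ?_⟩
  · have h := StieltjesConst.hasSum_log_series hu n
    have hn : (n : ℂ) + 1 ≠ 0 := by exact_mod_cast n.succ_ne_zero
    refine ⟨h.summable, ?_⟩
    rw [h.tsum_eq]
    field_simp
  · rw [StieltjesConst.subOneMulZeta_eq_hasse hu]
    exact StieltjesConst.differentiable_hasse hu
  · rw [StieltjesConst.subOneMulZeta_eq_hasse hu]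
    exact StieltjesConst.iteratedDeriv_succ_hasse_one hu n
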